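/- Let $n$ be a natural number. For $r\in\mathbb N$ and real symmetric $r\times r$ matrices $A_0,A_1,\dots,A_n$ we say that these matrices give a spectrahedral description of size $r$ of a set $C\subset\mathbb R^n$ if $$C=\{p\in\mathbb R^n:\ A_0+p_1A_1+\dots+p_nA_n\succeq 0\},$$ where $\succeq 0$ means positive semidefinite. Let $f\in\mathbb R[x_1,\dots,x_n]$ be a polynomial of degree $2$ such that $C=\{p\in\mathbb R^n: f(p)\ge 0\}$ is a compact, convex set with nonempty interior (for example $f=1-x_1^2-\dots-x_n^2$, $n\ge1$, where $C$ is the unit ball). Suppose that $C$ has a spectrahedral description of size $r$. Then: 1. for every integer $k\ge 0$, if $n>2^k$, then $r>2^k$; 2. in particular $r\ge \frac n2$; 3. and if $n=2^k+1$ for some integer $k\ge0$, then $r\ge n$. The bound in 3 is attained: if $n=2^k+1$ for some integer $k\ge 0$, then every such $C$ has a spectrahedral description of size $n$, so $n$ is the smallest possible size. For the closed Euclidean unit ball, and every $n\ge 2$, a description of size $n$ is the standard one, $$\{p\in\mathbb R^n:\ \|p\|_2\le 1\}=\left\{p\in\mathbb R^n:\ \begin{pmatrix}1+p_1&p_2&p_3&\cdots&p_n\\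 p_2&1-p_1&0&\cdots&0\\ p_3&0&1-p_1&\ddots&\vdots\\ \vdots&\vdots&\ddots&\ddots&0\\ p_n&0&\cdots&0&1-p_1\end{pmatrix}\succeq0\right\}.$$ -/

import Mathlib

/-- The superlevel set `{p ∈ ℝⁿ : f(p) ≥ 0}` of a real polynomial `f` in `n` variables. -/
def nonnegSet {n : ℕ} (f : MvPolynomial (Fin n) ℝ) : Set (EuclideanSpace ℝ (Fin n)) :=
  {p | 0 ≤ MvPolynomial.eval (fun i => p i) f}

/-- The solution set `{p ∈ ℝⁿ : A₀ + A₁ p₁ + ⋯ + Aₙ pₙ ⪰ 0}` of a linear matrix inequality of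
size `r`. -/
def lmiSet {n r : ℕ} (A₀ : Matrix (Fin r) (Fin r) ℝ) (A : Fin n → Matrix (Fin r) (Fin r) ℝ) :
    Set (EuclideanSpace ℝ (Fin n)) :=
  {p | (A₀ + ∑ i, p i • A i).PosSemidef}

/-- The matrices `A₀, A₁, …, Aₙ` are real symmetric of size `r` and give a spectrahedral
description of the set `C ⊆ ℝⁿ`. -/
def IsSpectrahedralDescription {n r : ℕ} (C : Set (EuclideanSpace ℝ (Fin n)))
    (A₀ : Matrix (Fin r) (Fin r) ℝ) (A : Fin n → Matrix (Fin r) (Fin r) ℝ) : Prop :=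
  A₀.IsSymm ∧ (∀ i, (A i).IsSymm) ∧ C = lmiSet A₀ A

/-- The set of all `r` such that `C` has a spectrahedral description by real symmetric
`r × r` matrices. -/
def descriptionSizes {n : ℕ} (C : Set (EuclideanSpace ℝ (Fin n))) : Set ℕ :=
  {r | ∃ (A₀ : Matrix (Fin r) (Fin r) ℝ) (A : Fin n → Matrix (Fin r) (Fin r) ℝ),
    IsSpectrahedralDescription C A₀ A}

/-- The coefficient matrices of the variables in the standard `n × n` linear matrix inequality
of the unit ball. The constant coefficient is the identity matrix. The first variable has
coefficient `diag(1, -1, …, -1)`; for `l` different from the first index, the coefficient has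
entries `1` at the positions `(first, l)` and `(l, first)` and zeros elsewhere. -/
def standardBallCoeff (n : ℕ) (l : Fin n) : Matrix (Fin n) (Fin n) ℝ :=
  Matrix.of fun i j =>
    if l.val = 0 then (if i = j then (if i.val = 0 then 1 else -1) else 0)
    else if (i.val = 0 ∧ j = l) ∨ (i = l ∧ j.val = 0) then 1 else 0

/-! Compactness and nonempty interior force C to be an ellipsoid, and an invertible affine map
carries it to the unit ball without changing the possible sizes
(`descriptionSizes_nonnegSet_eq_ball`). Everything thus reduces to the ball.

The lower bound comes from quadratic form theory. Put N = x₁² + ⋯ + xₙ². The constant term of a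
description of the ball can be made a positive definite M. The matrix is singular on the unit
sphere, so √N·M + ∑ xᵢAᵢ is singular at every real point. A kernel vector a + √N·b with polynomial
a, b satisfies aᵀMa = N·bᵀMb, and writing M = SᵀS exhibits N as a quotient of two sums of r squares
(`Matrix.exists_sum_sq_of_ball_pencil`).

If r ≤ 2^k, Pfister's multiplicativity of sums of 2^k squares (`sum_sq_mul_sum_sq`) makes N a sum of
2^k squares in ℝ(x₁, …, xₙ). By Cassels (`cassels_not_sum_sq`) this is impossible when 2^k < n. The
standard description of the ball gives the matching upper bound. -/

/-! ### Anisotropy of sums of squares -/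

/-- A commutative ring in which a finite sum of squares vanishes only if all summands do. -/
def SumSqAnisotropic (R : Type*) [CommRing R] : Prop :=
  ∀ (m : ℕ) (p : Fin m → R), ∑ i, p i ^ 2 = 0 → ∀ i, p i = 0

theorem MvPolynomial.sumSqAnisotropic (σ : Type*) : SumSqAnisotropic (MvPolynomial σ ℝ) := by
  intro m p h i
  refine MvPolynomial.funext fun x => ?_
  have h1 := congrArg (MvPolynomial.eval x) h
  simp only [map_sum, map_pow, map_zero] at h1
  rw [Finset.sum_eq_zero_iff_of_nonneg (fun _ _ => sq_nonneg _)] at h1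
  simpa using h1 i (Finset.mem_univ i)

theorem exists_common_denom {R : Type*} [CommRing R] [IsDomain R] {m : ℕ}
    (p : Fin m → FractionRing R) :
    ∃ (h : R) (g : Fin m → R), h ≠ 0 ∧
      ∀ i, algebraMap R (FractionRing R) (g i) = algebraMap R (FractionRing R) h * p i := by
  obtain ⟨b, hb⟩ := IsLocalization.exist_integer_multiples_of_finite (nonZeroDivisors R) p
  choose g hg using hb
  exact ⟨b, g, nonZeroDivisors.ne_zero b.2, fun i => by rw [hg i, Algebra.smul_def]⟩

theorem SumSqAnisotropic.fractionRing {R : Type*} [CommRing R] [IsDomain R]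
    (hR : SumSqAnisotropic R) : SumSqAnisotropic (FractionRing R) := by
  intro m p hp i
  obtain ⟨h, g, hh, hg⟩ := exists_common_denom p
  have hinj := IsFractionRing.injective R (FractionRing R)
  have hs : ∑ i, g i ^ 2 = 0 := by
    apply hinj
    simp only [map_sum, map_pow, hg, mul_pow, map_zero]
    rw [← Finset.mul_sum, hp, mul_zero]
  have h1 := hg i
  rw [hR m g hs i, map_zero, eq_comm, mul_eq_zero] at h1
  exact h1.resolve_left fun h2 => hh (hinj (by rw [h2, map_zero]))

theorem SumSqAnisotropic.polynomial {K : Type*} [Field K] [Infinite K]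
    (hK : SumSqAnisotropic K) : SumSqAnisotropic (Polynomial K) := by
  intro m p h i
  refine Polynomial.funext fun x => ?_
  have h1 := congrArg (Polynomial.eval x) h
  simp only [Polynomial.eval_finsetSum, Polynomial.eval_pow, Polynomial.eval_zero] at h1
  simpa using hK m _ h1 i

/-! ### Cassels–Pfister descent and Cassels' theorem -/

/-- One step of the Cassels–Pfister descent: the second intersection point of the line through
`α / h` and `q` with the quadric `∑ yᵢ² = p`. -/
theorem cassels_reflection {R : Type*} [CommRing R] {m : ℕ} {p h : R} {α q : Fin m → R}
    (H : ∑ i, α i ^ 2 = p * h ^ 2) :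
    ∃ (h' : R) (α' : Fin m → R), ∑ i, α' i ^ 2 = p * h' ^ 2 ∧
      h * h' = ∑ i, (α i - h * q i) ^ 2 := by
  set s := ∑ i, q i ^ 2 with hs
  set t := ∑ i, α i * q i with ht
  -- On the line q + l(α/h - q) the quadric has the root l = 1; the other is l = (s - p)h/h'. Here
  -- h' = h·∑(αᵢ/h - qᵢ)², and α'/h' is the second point.
  refine ⟨(s - p) * h + 2 * (p * h - t), fun i => (s - p) * α i + 2 * (p * h - t) * q i, ?_, ?_⟩
  · have : ∀ i, ((s - p) * α i + 2 * (p * h - t) * q i) ^ 2 =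
        (s - p) ^ 2 * α i ^ 2 + 2 * (s - p) * (2 * (p * h - t)) * (α i * q i) +
          (2 * (p * h - t)) ^ 2 * q i ^ 2 := fun i => by ring
    simp only [this, Finset.sum_add_distrib, ← Finset.mul_sum, H, ← hs, ← ht]
    ring
  · have : ∀ i, (α i - h * q i) ^ 2 = α i ^ 2 - 2 * h * (α i * q i) + h ^ 2 * q i ^ 2 :=
      fun i => by ring
    simp only [this, Finset.sum_add_distrib, Finset.sum_sub_distrib, ← Finset.mul_sum, H, ← hs,
      ← ht]
    ring

/-- The **Cassels–Pfister theorem** for sums of squares. -/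
theorem cassels_pfister {K : Type*} [Field K] [Infinite K] (hK : SumSqAnisotropic K) {m : ℕ}
    (p : Polynomial K) : ∀ (h : Polynomial K) (α : Fin m → Polynomial K), h ≠ 0 →
      ∑ i, α i ^ 2 = p * h ^ 2 → ∃ γ : Fin m → Polynomial K, ∑ i, γ i ^ 2 = p := by
  intro h
  induction hd : h.degree using WellFoundedLT.induction generalizing h with
  | _ d ih =>
  intro α hh H
  subst hd
  by_cases hr : ∀ i, α i % h = 0
  · refine ⟨fun i => α i / h, mul_right_cancel₀ (pow_ne_zero 2 hh) ?_⟩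
    rw [← H, Finset.sum_mul]
    refine Finset.sum_congr rfl fun i _ => ?_
    rw [← mul_pow, mul_comm, EuclideanDomain.mul_div_cancel' hh
      ((EuclideanDomain.mod_eq_zero).1 (hr i))]
  -- With q the polynomial quotients, h·h' is the sum of the squared remainders. Its degree is below
  -- 2 deg h, so deg h' < deg h, and anisotropy keeps h' nonzero.
  · obtain ⟨h', α', H', hh'⟩ := cassels_reflection (q := fun i => α i / h) H
    have hmod : ∀ i, α i - h * (α i / h) = α i % h := fun i => by
      rw [sub_eq_iff_eq_add, add_comm, EuclideanDomain.div_add_mod]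
    simp only [hmod] at hh'
    have h'0 : h' ≠ 0 := by
      rintro rfl
      rw [mul_zero] at hh'
      exact hr (hK.polynomial m _ hh'.symm)
    refine ih h'.degree ?_ h' rfl α' h'0 H'
    by_contra! hlt
    have h1 : (h * h').degree < h.degree + h.degree := by
      rw [hh']
      refine lt_of_le_of_lt (Polynomial.degree_sum_le _ _) ?_
      rw [Finset.sup_lt_iff (by
        rw [← Polynomial.degree_mul]; exact bot_lt_iff_ne_bot.2 (by simp [hh]))]
      intro i _
      have h2 : (α i % h).degree < h.degree := EuclideanDomain.mod_lt _ hh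
      rw [sq, Polynomial.degree_mul]
      rw [Polynomial.degree_eq_natDegree hh] at h2 ⊢
      by_cases h3 : α i % h = 0
      · rw [h3]; simp only [Polynomial.degree_zero, WithBot.bot_add]
        exact WithBot.bot_lt_coe _
      · rw [Polynomial.degree_eq_natDegree h3] at h2 ⊢
        norm_cast at h2 ⊢
        omega
    rw [Polynomial.degree_mul, Polynomial.degree_eq_natDegree hh,
      Polynomial.degree_eq_natDegree h'0] at h1
    rw [Polynomial.degree_eq_natDegree hh, Polynomial.degree_eq_natDegree h'0] at hlt
    norm_cast at h1 hlt
    omega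

/-- If `t² + d` is a sum of `m + 1` squares in `K(t)`, then `d` is a sum of `m` squares in `K`. -/
theorem sum_sq_of_X_sq_add_C {K : Type*} [Field K] [CharZero K] (hK : SumSqAnisotropic K) {m : ℕ}
    {d : K} {h : Polynomial K} {α : Fin (m + 1) → Polynomial K} (hh : h ≠ 0)
    (H : ∑ i, α i ^ 2 = (Polynomial.X ^ 2 + Polynomial.C d) * h ^ 2) :
    ∃ γ : Fin m → K, ∑ i, γ i ^ 2 = d := by
  have : Infinite K := inferInstance
  obtain ⟨γ, hγ⟩ := cassels_pfister hK _ h α hh H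
  -- By anisotropy the squares of the top coefficients cannot cancel, so no γᵢ has degree above 1.
  have hdeg : ∀ i, (γ i).natDegree ≤ 1 := by
    by_contra! hcon
    obtain ⟨j, hj⟩ := hcon
    obtain ⟨i, -, hi⟩ := Finset.exists_max_image Finset.univ (fun i => (γ i).natDegree)
      ⟨j, Finset.mem_univ j⟩
    set D := (γ i).natDegree with hD
    have hD2 : 2 ≤ D := le_trans hj (hi j (Finset.mem_univ j))
    have hc := congrArg (fun P => Polynomial.coeff P (2 * D)) hγ
    simp only [Polynomial.finsetSum_coeff] at hc
    have h0 : (Polynomial.X ^ 2 + Polynomial.C d : Polynomial K).coeff (2 * D) = 0 := by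
      rw [Polynomial.coeff_add, Polynomial.coeff_X_pow, Polynomial.coeff_C]
      simp only [show 2 * D ≠ 2 by omega, show 2 * D ≠ 0 by omega, if_false, add_zero]
    rw [h0] at hc
    have h1 : ∀ l, (γ l ^ 2).coeff (2 * D) = ((γ l).coeff D) ^ 2 := fun l => by
      exact Polynomial.coeff_pow_of_natDegree_le (hi l (Finset.mem_univ l))
    simp only [h1] at hc
    have h2 := hK _ _ hc i
    rw [hD, Polynomial.coeff_natDegree, Polynomial.leadingCoeff_eq_zero] at h2
    rw [h2, Polynomial.natDegree_zero] at hD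
    omega
  have hlin : ∀ i, γ i = Polynomial.C ((γ i).coeff 1) * Polynomial.X +
      Polynomial.C ((γ i).coeff 0) := fun i => Polynomial.eq_X_add_C_of_natDegree_le_one (hdeg i)
  -- For the last γ = at + b, solve γ(c) = c, or γ(c) = -c when a = 1. Evaluating at c then cancels
  -- c² against the last square and leaves d as a sum of m squares.
  obtain ⟨c, hc⟩ : ∃ c : K, (Polynomial.eval c (γ (Fin.last m))) ^ 2 = c ^ 2 := by
    rw [hlin]
    simp only [Polynomial.eval_add, Polynomial.eval_mul, Polynomial.eval_C, Polynomial.eval_X]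
    set a := (γ (Fin.last m)).coeff 1
    set b := (γ (Fin.last m)).coeff 0
    by_cases ha : a = 1
    · refine ⟨-b / 2, ?_⟩
      rw [ha]; ring
    · refine ⟨b / (1 - a), ?_⟩
      have : 1 - a ≠ 0 := sub_ne_zero.2 (Ne.symm ha)
      congr 1
      field_simp
      ring
  refine ⟨fun i => Polynomial.eval c (γ i.castSucc), ?_⟩
  have he := congrArg (Polynomial.eval c) hγ
  rw [Fin.sum_univ_castSucc] at he
  simp only [Polynomial.eval_add, Polynomial.eval_finsetSum, Polynomial.eval_pow,
    Polynomial.eval_C, Polynomial.eval_X, hc] at he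
  linear_combination he

/-- **Cassels' theorem**: `x₁² + ⋯ + xₙ²` is not a sum of fewer than `n` squares in
`ℝ(x₁, …, xₙ)`. -/
theorem cassels_not_sum_sq : ∀ (n m : ℕ), m < n → ∀ (h : MvPolynomial (Fin n) ℝ)
    (α : Fin m → MvPolynomial (Fin n) ℝ), h ≠ 0 →
      ∑ i, α i ^ 2 ≠ (∑ i, MvPolynomial.X i ^ 2) * h ^ 2 := by
  intro n
  induction n with
  | zero => intro m hm; omega
  | succ n ih =>
  intro m hm h α hh H
  let R := MvPolynomial (Fin n) ℝ
  let K := FractionRing R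
  have hK : SumSqAnisotropic K := (MvPolynomial.sumSqAnisotropic (Fin n)).fractionRing
  have hinj : Function.Injective (algebraMap R K) := IsFractionRing.injective R K
  have : CharZero K := charZero_of_injective_algebraMap hinj
  -- Over K, the rational functions in the remaining variables, the sum reads t² + d with t the
  -- first variable. Removing one square from each side leads to the induction hypothesis.
  let φ : MvPolynomial (Fin (n + 1)) ℝ →+* Polynomial K :=
    (Polynomial.mapRingHom (algebraMap R K)).comp (MvPolynomial.finSuccEquiv ℝ n : _ →+* _)
  have hφ : Function.Injective φ :=
    (Polynomial.map_injective _ hinj).comp (MvPolynomial.finSuccEquiv ℝ n).injective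
  have hφ0 : φ (MvPolynomial.X 0) = Polynomial.X := by
    simp [φ, MvPolynomial.finSuccEquiv_X_zero]
  have hφs : ∀ i : Fin n, φ (MvPolynomial.X i.succ) =
      Polynomial.C (algebraMap R K (MvPolynomial.X i)) := fun i => by
    simp [φ, MvPolynomial.finSuccEquiv_X_succ, R]
  have H' := congrArg φ H
  rw [map_mul, map_pow, map_sum, map_sum, Fin.sum_univ_succ] at H'
  simp only [map_pow, hφ0, hφs] at H'
  have hd : ∑ i : Fin n, Polynomial.C (algebraMap R K (MvPolynomial.X i)) ^ 2 =
      Polynomial.C (algebraMap R K (∑ i, MvPolynomial.X i ^ 2)) := by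
    simp only [map_sum, map_pow]
  rw [hd] at H'
  have hφh : φ h ≠ 0 := fun h0 => hh (hφ (by rw [h0, map_zero]))
  cases m with
  | zero =>
    rw [Finset.univ_eq_empty, Finset.sum_empty, eq_comm, mul_eq_zero] at H'
    rcases H' with H' | H'
    · exact Polynomial.X_pow_add_C_ne_zero two_pos _ H'
    · exact pow_ne_zero 2 hφh H'
  | succ m =>
    obtain ⟨γ, hγ⟩ := sum_sq_of_X_sq_add_C hK hφh H'
    obtain ⟨b, g, hb, hg⟩ := exists_common_denom γ
    have hg' : ∀ i, algebraMap R K (g i) = algebraMap R K b * γ i := hg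
    refine ih m (by omega) b g hb (hinj ?_)
    simp only [map_sum, map_pow, map_mul, hg', mul_pow]
    rw [← Finset.mul_sum, hγ, mul_comm]
    simp only [map_sum, map_pow]

/-! ### Pfister's multiplicativity of sums of 2^k squares -/

open Matrix in
/-- **Pfister**: a sum of `2 ^ k` squares is a similarity factor of the form `y ↦ ∑ yᵢ²` in
`2 ^ k` variables. -/
theorem exists_similarity_of_sum_sq {K : Type*} [Field K] (hK : SumSqAnisotropic K) (k : ℕ) :
    ∀ x : Fin (2 ^ k) → K, ∃ T : Matrix (Fin (2 ^ k)) (Fin (2 ^ k)) K,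
      T * Tᵀ = (∑ i, x i ^ 2) • 1 ∧ Tᵀ * T = (∑ i, x i ^ 2) • 1 := by
  induction k with
  | zero =>
    intro x
    refine ⟨diagonal x, ?_, ?_⟩ <;>
    · ext i j
      have hi : i = 0 := Subsingleton.elim (α := Fin 1) _ _
      have hj : j = 0 := Subsingleton.elim (α := Fin 1) _ _
      subst hi hj
      simp [sq]
  | succ k ih =>
    intro x
    let e : Fin (2 ^ k) ⊕ Fin (2 ^ k) ≃ Fin (2 ^ (k + 1)) :=
      finSumFinEquiv.trans (finCongr (by rw [pow_succ, mul_two]))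
    obtain ⟨S, hS, hS'⟩ := ih (fun i => x (e (Sum.inl i)))
    obtain ⟨T, hT, hT'⟩ := ih (fun i => x (e (Sum.inr i)))
    have hsum : ∑ i, x i ^ 2 =
        ∑ i, x (e (Sum.inl i)) ^ 2 + ∑ i, x (e (Sum.inr i)) ^ 2 := by
      rw [← Equiv.sum_comp e, Fintype.sum_sum_type]
    set Y := ∑ i, x (e (Sum.inl i)) ^ 2
    set Z := ∑ i, x (e (Sum.inr i)) ^ 2
    rw [hsum]
    obtain ⟨M, hM⟩ : ∃ M : Matrix (Fin (2 ^ k) ⊕ Fin (2 ^ k)) (Fin (2 ^ k) ⊕ Fin (2 ^ k)) K,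
        M * Mᵀ = (Y + Z) • 1 := by
      by_cases hY : Y = 0
      · refine ⟨fromBlocks T 0 0 T, ?_⟩
        rw [fromBlocks_transpose, fromBlocks_multiply, ← fromBlocks_one, fromBlocks_smul]
        simp [hT, hY]
      -- The lower left block is chosen to make the two block rows orthogonal.
      · refine ⟨fromBlocks S T (-(Y⁻¹ • (S * Tᵀ * S))) S, ?_⟩
        rw [fromBlocks_transpose, fromBlocks_multiply, ← fromBlocks_one, fromBlocks_smul]
        have h1 : S * (S * Tᵀ * S)ᵀ = Y • (T * Sᵀ) := by
          simp only [transpose_mul, transpose_transpose]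
          rw [← mul_assoc, hS, smul_mul_assoc, one_mul]
        have h2 : S * Tᵀ * S * Sᵀ = Y • (S * Tᵀ) := by
          rw [mul_assoc, hS, mul_smul_comm, mul_one]
        have h3 : S * Tᵀ * S * (S * Tᵀ * S)ᵀ = (Y * Y * Z) • 1 := by
          rw [mul_assoc (S * Tᵀ), h1, mul_smul_comm, mul_assoc, ← mul_assoc Tᵀ, hT', smul_mul_assoc, one_mul,
            mul_smul_comm, hS, smul_smul, smul_smul]
          congr 1; ring
        congr 1
        · rw [hS, hT, add_smul]
        · rw [transpose_neg, transpose_smul, mul_neg, mul_smul_comm, h1, smul_smul, inv_mul_cancel₀ hY,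
            one_smul, neg_add_cancel, smul_zero]
        · rw [neg_mul, smul_mul_assoc, h2, smul_smul, inv_mul_cancel₀ hY,
            one_smul, neg_add_cancel, smul_zero]
        · rw [transpose_neg, transpose_smul, mul_neg, neg_mul, neg_neg, mul_smul_comm, smul_mul_assoc, h3, hS,
            smul_smul, smul_smul, add_comm, ← add_smul]
          congr 1; field_simp
    -- If Y + Z = 0, the rows of M have zero sum of squares, so M = 0. Otherwise a one-sided inverse
    -- is two-sided.
    have hM' : Mᵀ * M = (Y + Z) • 1 := by
      by_cases h0 : Y + Z = 0
      · rw [h0, zero_smul] at hM ⊢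
        have hM0 : M = 0 := by
          ext i j
          have h1 := congrFun (congrFun hM i) i
          simp only [mul_apply, transpose_apply, Matrix.zero_apply, ← sq] at h1
          rw [← Equiv.sum_comp e.symm] at h1
          simpa using hK _ _ h1 (e j)
        rw [hM0, mul_zero]
      · have h1 : M * ((Y + Z)⁻¹ • Mᵀ) = 1 := by
          rw [mul_smul_comm, hM, smul_smul, inv_mul_cancel₀ h0, one_smul]
        have h2 := mul_eq_one_comm.1 h1
        rw [smul_mul_assoc] at h2
        rw [← h2, smul_smul, mul_inv_cancel₀ h0, one_smul]
    refine ⟨M.submatrix e.symm e.symm, ?_, ?_⟩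
    · rw [transpose_submatrix, submatrix_mul_equiv, hM, submatrix_smul, Pi.smul_apply,
        Pi.smul_apply, submatrix_one_equiv]
    · rw [transpose_submatrix, submatrix_mul_equiv, hM', submatrix_smul, Pi.smul_apply,
        Pi.smul_apply, submatrix_one_equiv]

open Matrix in
/-- The product of two sums of `2 ^ k` squares is a sum of `2 ^ k` squares. -/
theorem sum_sq_mul_sum_sq {K : Type*} [Field K] (hK : SumSqAnisotropic K) (k : ℕ)
    (x y : Fin (2 ^ k) → K) :
    ∃ z : Fin (2 ^ k) → K, ∑ i, z i ^ 2 = (∑ i, x i ^ 2) * ∑ i, y i ^ 2 := by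
  obtain ⟨T, -, hT⟩ := exists_similarity_of_sum_sq hK k x
  have hsq : ∀ w : Fin (2 ^ k) → K, ∑ i, w i ^ 2 = w ⬝ᵥ w := fun w => by
    simp only [dotProduct, sq]
  refine ⟨T *ᵥ y, ?_⟩
  rw [hsq, dotProduct_mulVec, vecMul_mulVec, hT, ← dotProduct_mulVec, smul_mulVec, one_mulVec, dotProduct_smul,
    smul_eq_mul, hsq y]

theorem exists_sum_sq_of_le {R : Type*} [CommRing R] {r m : ℕ} (hr : r ≤ m) (x : Fin r → R) :
    ∃ y : Fin m → R, ∑ i, y i ^ 2 = ∑ i, x i ^ 2 := by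
  obtain ⟨d, rfl⟩ := Nat.exists_eq_add_of_le hr
  refine ⟨Fin.append x 0, ?_⟩
  rw [Fin.sum_univ_add]
  simp

/-- If `N` is a quotient of two sums of at most `2 ^ k` squares, then it is a sum of `2 ^ k` squares
in the fraction field. -/
theorem SumSqAnisotropic.exists_sum_two_pow_sq {R : Type*} [CommRing R] [IsDomain R]
    (hR : SumSqAnisotropic R) {r k : ℕ} (hr : r ≤ 2 ^ k) {N : R} {α β : Fin r → R} (hβ : β ≠ 0)
    (H : ∑ i, α i ^ 2 = N * ∑ i, β i ^ 2) :
    ∃ (h : R) (g : Fin (2 ^ k) → R), h ≠ 0 ∧ ∑ i, g i ^ 2 = N * h ^ 2 := by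
  obtain ⟨a, ha⟩ := exists_sum_sq_of_le hr (fun i => algebraMap R (FractionRing R) (α i))
  obtain ⟨b, hb⟩ := exists_sum_sq_of_le hr (fun i => algebraMap R (FractionRing R) (β i))
  obtain ⟨z, hz⟩ := sum_sq_mul_sum_sq hR.fractionRing k a b
  obtain ⟨h, g, hh, hg⟩ := exists_common_denom z
  have hβ0 : ∑ i, β i ^ 2 ≠ 0 := fun h0 => hβ (funext (hR r β h0))
  -- A/B = AB/B², and AB is a sum of 2^k squares by multiplicativity.
  refine ⟨h * ∑ i, β i ^ 2, g, mul_ne_zero hh hβ0, IsFractionRing.injective R (FractionRing R) ?_⟩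
  have hz' : ∑ i, z i ^ 2 =
      algebraMap R (FractionRing R) ((∑ i, α i ^ 2) * ∑ i, β i ^ 2) := by
    rw [hz, ha, hb, map_mul, map_sum, map_sum]
    simp only [map_pow]
  rw [map_sum]
  simp only [map_pow, hg, mul_pow]
  rw [← Finset.mul_sum, hz', H, ← map_pow, ← map_mul]
  congr 1
  ring

/-- If `x₁² + ⋯ + xₙ²` is a quotient of two sums of `r` squares of real polynomials and
`2 ^ k < n`, then `2 ^ k < r`. -/
theorem two_pow_lt_of_sum_sq_eq {n r k : ℕ} (hk : 2 ^ k < n)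
    {α β : Fin r → MvPolynomial (Fin n) ℝ} (hβ : β ≠ 0)
    (H : ∑ i, α i ^ 2 = (∑ i, MvPolynomial.X i ^ 2) * ∑ i, β i ^ 2) : 2 ^ k < r := by
  by_contra! hr
  obtain ⟨h, g, hh, hg⟩ :=
    (MvPolynomial.sumSqAnisotropic (Fin n)).exists_sum_two_pow_sq hr hβ H
  exact cassels_not_sum_sq n (2 ^ k) hk h g hh hg

/-! ### From a description of the ball to an identity of sums of squares -/

namespace Matrix

/-- On the compact unit sphere the form of G is at least some δ > 0 and that of B is bounded;
homogeneity extends the estimate to all vectors. -/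
theorem PosDef.exists_posSemidef_add_smul {ι : Type*} [Fintype ι] {G B : Matrix ι ι ℝ}
    (hG : G.PosDef) (hB : B.IsHermitian) : ∃ ε : ℝ, 0 < ε ∧ (G + ε • B).PosSemidef := by
  have hcont : ∀ C : Matrix ι ι ℝ, Continuous fun v : ι → ℝ => v ⬝ᵥ C *ᵥ v := fun C => by
    simp only [dotProduct, mulVec]
    fun_prop
  have hS : IsCompact (Metric.sphere (0 : ι → ℝ) 1) := isCompact_sphere 0 1
  obtain ⟨δ, hδ, hδS⟩ := hS.exists_forall_le' (hcont G).continuousOn (a := 0) fun v hv => by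
    have hv0 : v ≠ 0 := by
      rintro rfl
      simp at hv
    simpa using hG.dotProduct_mulVec_pos hv0
  obtain ⟨c, hc⟩ := hS.exists_bound_of_continuousOn (hcont B).continuousOn
  refine ⟨δ / (|c| + 1), by positivity, .of_dotProduct_mulVec_nonneg ?_ fun v => ?_⟩
  · exact hG.isHermitian.add (by rw [IsHermitian, conjTranspose_smul, hB.eq, star_trivial])
  · rw [star_trivial, add_mulVec, smul_mulVec, dotProduct_add, dotProduct_smul, smul_eq_mul]
    by_cases hv : v = 0
    · simp [hv]
    have hn : 0 < ‖v‖ := norm_pos_iff.2 hv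
    set w := ‖v‖⁻¹ • v with hw
    have hwS : w ∈ Metric.sphere (0 : ι → ℝ) 1 := by
      simp [hw, norm_smul, hn.ne']
    have hvw : v = ‖v‖ • w := by rw [hw, smul_smul, mul_inv_cancel₀ hn.ne', one_smul]
    have h1 := hδS w hwS
    have h2 := (abs_le.1 (hc w hwS)).1
    have h3 : 0 ≤ w ⬝ᵥ G *ᵥ w + δ / (|c| + 1) * (w ⬝ᵥ B *ᵥ w) := by
      have h4 : -(|c| + 1) ≤ w ⬝ᵥ B *ᵥ w := by linarith [le_abs_self c]
      have h5 : δ / (|c| + 1) * -(|c| + 1) ≤ δ / (|c| + 1) * (w ⬝ᵥ B *ᵥ w) :=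
        mul_le_mul_of_nonneg_left h4 (by positivity)
      have h6 : δ / (|c| + 1) * -(|c| + 1) = -δ := by
        field_simp
      linarith
    rw [hvw]
    simp only [mulVec_smul, dotProduct_smul, smul_dotProduct, smul_eq_mul]
    calc (0 : ℝ) ≤ ‖v‖ ^ 2 * (w ⬝ᵥ G *ᵥ w + δ / (|c| + 1) * (w ⬝ᵥ B *ᵥ w)) := by positivity
      _ = _ := by ring

open scoped MatrixOrder in
theorem PosSemidef.exists_eq_transpose_mul_self {ι : Type*} [Fintype ι] [DecidableEq ι]
    {A : Matrix ι ι ℝ} (hA : A.PosSemidef) : ∃ S : Matrix ι ι ℝ, A = Sᵀ * S := by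
  obtain ⟨S, hS⟩ := CStarAlgebra.nonneg_iff_eq_star_mul_self.mp hA.nonneg
  exact ⟨S, by rw [hS, star_eq_conjTranspose, conjTranspose_eq_transpose_of_trivial]⟩

/-- The orthogonal projection onto the kernel of a positive semidefinite matrix. -/
theorem PosSemidef.exists_kernel_projection {ι : Type*} [Fintype ι] [DecidableEq ι]
    {A : Matrix ι ι ℝ} (hA : A.PosSemidef) :
    ∃ Q : Matrix ι ι ℝ, Q.PosSemidef ∧ Q * Q = Q ∧ A * Q = 0 ∧ (A + Q).PosDef := by
  let U : Matrix ι ι ℝ := hA.1.eigenvectorUnitary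
  have hU : star U * U = 1 := Unitary.coe_star_mul_self hA.1.eigenvectorUnitary
  have hUu : IsUnit U := ⟨Unitary.toUnits hA.1.eigenvectorUnitary, rfl⟩
  let d : ι → ℝ := hA.1.eigenvalues
  let e : ι → ℝ := fun i => if d i = 0 then 1 else 0
  have hAU : A = U * diagonal d * star U := by
    conv_lhs => rw [hA.1.spectral_theorem, Unitary.conjStarAlgAut_apply]
    rfl
  have hmul : ∀ a b : ι → ℝ, (U * diagonal a * star U) * (U * diagonal b * star U) =
      U * diagonal (fun i => a i * b i) * star U := fun a b => by
    rw [← diagonal_mul_diagonal]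
    calc _ = U * diagonal a * (star U * U) * diagonal b * star U := by simp only [mul_assoc]
      _ = _ := by rw [hU, mul_one]; simp only [mul_assoc]
  refine ⟨U * diagonal e * star U, ?_, ?_, ?_, ?_⟩
  · rw [IsUnit.posSemidef_star_right_conjugate_iff hUu, posSemidef_diagonal_iff]
    intro i
    simp only [e]
    split_ifs <;> norm_num
  · rw [hmul]
    congr 3
    ext i
    simp only [e]
    split_ifs <;> norm_num
  · rw [hAU, hmul]
    have : (fun i => d i * e i) = 0 := by
      ext i
      by_cases h : d i = 0 <;> simp [e, h]
    rw [this]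
    simp
  · rw [hAU, ← add_mul, ← mul_add, diagonal_add, IsUnit.posDef_star_right_conjugate_iff hUu,
      posDef_diagonal_iff]
    intro i
    have hd : 0 ≤ d i := hA.eigenvalues_nonneg i
    by_cases h : d i = 0
    · simp [e, h]
    · simpa [e, h] using lt_of_le_of_ne hd (Ne.symm h)

/-- A linear matrix inequality describing the unit ball may be chosen with positive definite
constant coefficient. -/
theorem exists_posDef_of_ball_pencil {n r : ℕ} {A₀ : Matrix (Fin r) (Fin r) ℝ}
    {A : Fin n → Matrix (Fin r) (Fin r) ℝ} (hA : ∀ i, (A i).IsSymm)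
    (H : ∀ p : Fin n → ℝ, (A₀ + ∑ i, p i • A i).PosSemidef ↔ ∑ i, p i ^ 2 ≤ 1) :
    ∃ M : Matrix (Fin r) (Fin r) ℝ, M.PosDef ∧
      ∀ p : Fin n → ℝ, (M + ∑ i, p i • A i).PosSemidef ↔ ∑ i, p i ^ 2 ≤ 1 := by
  have h0 : A₀.PosSemidef := by simpa using (H 0).2 (by simp)
  have hpm : ∀ (i : Fin n) (s : ℝ), s ^ 2 = 1 → (A₀ + s • A i).PosSemidef := by
    intro i s hs
    have := (H (Pi.single i s)).2 (by
      rw [Finset.sum_eq_single i (fun j _ hj => by simp [hj]) (by simp)]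
      simp [hs])
    rwa [Finset.sum_eq_single i (fun j _ hj => by simp [hj]) (by simp), Pi.single_eq_same] at this
  -- Both A₀ + Aᵢ and A₀ - Aᵢ are positive semidefinite, so the form of Aᵢ vanishes on ker A₀. A
  -- semidefinite matrix annihilates its isotropic vectors.
  have hker : ∀ (i : Fin n) (u : Fin r → ℝ), A₀ *ᵥ u = 0 → A i *ᵥ u = 0 := by
    intro i u hu
    have h1 := (hpm i 1 (by norm_num)).dotProduct_mulVec_nonneg u
    have h2 := (hpm i (-1) (by norm_num)).dotProduct_mulVec_nonneg u
    simp only [star_trivial, add_mulVec, hu, zero_add, one_smul, neg_smul,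
      neg_mulVec, dotProduct_neg] at h1 h2
    have h3 : star u ⬝ᵥ (A₀ + (1 : ℝ) • A i) *ᵥ u = 0 := by
      simp only [star_trivial, add_mulVec, hu, zero_add, one_smul]
      linarith
    rw [(hpm i 1 (by norm_num)).dotProduct_mulVec_zero_iff, add_mulVec, hu, zero_add,
      one_smul] at h3
    exact h3
  obtain ⟨Q, hQ, hQQ, hAQ, hpos⟩ := h0.exists_kernel_projection
  have hQt : Qᵀ = Q := by simpa using hQ.1.eq
  have hA₀t : A₀ᵀ = A₀ := by simpa using h0.1.eq
  have hAiQ : ∀ i, A i * Q = 0 := fun i => by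
    ext a b
    have h1 : A₀ *ᵥ (fun k => Q k b) = 0 := by
      ext a
      exact congrFun (congrFun hAQ a) b
    exact congrFun (hker i _ h1) a
  have hQAi : ∀ i, Q * A i = 0 := fun i => by
    have h1 := congrArg transpose (hAiQ i)
    rwa [transpose_mul, hQt, (hA i).eq, transpose_zero] at h1
  have hQA₀ : Q * A₀ = 0 := by
    have h1 := congrArg transpose hAQ
    rwa [transpose_mul, hQt, hA₀t, transpose_zero] at h1
  refine ⟨A₀ + Q, hpos, fun p => ?_⟩
  rw [← H p]
  have hPQ : (A₀ + ∑ i, p i • A i) * Q = 0 := by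
    simp [add_mul, Finset.sum_mul, hAQ, hAiQ]
  have hQP : Q * (A₀ + ∑ i, p i • A i) = 0 := by
    simp [mul_add, Finset.mul_sum, hQA₀, hQAi]
  rw [add_right_comm]
  generalize A₀ + ∑ i, p i • A i = P at hPQ hQP
  refine ⟨fun h => ?_, fun h => h.add hQ⟩
  -- P lives on the range of 1 - Q, so compressing to it removes Q and keeps P.
  have h1 := h.conjTranspose_mul_mul_same (1 - Q)
  have h2 : (1 - Q)ᴴ * (P + Q) * (1 - Q) = P := by
    rw [conjTranspose_sub, conjTranspose_one, hQ.1.eq]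
    simp only [sub_mul, mul_sub, mul_add, add_mul, one_mul, mul_one, hPQ, hQP, hQQ]
    simp
  rwa [h2] at h1

/-- After scaling, x lies on the unit sphere. Were the matrix nonsingular there, it would be
positive definite and would stay semidefinite slightly outside the ball. -/
theorem exists_ball_pencil_kernel {n r : ℕ} (hn : 0 < n) {M : Matrix (Fin r) (Fin r) ℝ}
    {A : Fin n → Matrix (Fin r) (Fin r) ℝ} (hA : ∀ i, (A i).IsSymm)
    (H : ∀ p : Fin n → ℝ, (M + ∑ i, p i • A i).PosSemidef ↔ ∑ i, p i ^ 2 ≤ 1) (x : Fin n → ℝ) :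
    ∃ u ≠ 0, (√(∑ i, x i ^ 2) • M + ∑ i, x i • A i) *ᵥ u = 0 := by
  -- Size 0 would describe the whole space.
  have hne : Nonempty (Fin r) := by
    by_contra he
    have he' : IsEmpty (Fin r) := not_nonempty_iff.1 he
    have h1 := (H (Pi.single ⟨0, hn⟩ 2)).1 (by
      convert PosSemidef.zero (n := Fin r) (R := ℝ) using 1
      exact Subsingleton.elim _ _)
    rw [Finset.sum_eq_single ⟨0, hn⟩ (fun j _ hj => by simp [hj]) (by simp)] at h1
    norm_num at h1
  by_cases hx : x = 0
  · exact ⟨1, one_ne_zero, by simp [hx]⟩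
  have hpos : 0 < ∑ i, x i ^ 2 := by
    obtain ⟨i, hi⟩ := Function.ne_iff.1 hx
    exact Finset.sum_pos' (fun _ _ => sq_nonneg _) ⟨i, Finset.mem_univ i, by
      have : x i ≠ 0 := hi
      positivity⟩
  set s := √(∑ i, x i ^ 2) with hs
  have hs0 : 0 < s := Real.sqrt_pos.2 hpos
  have hs2 : s ^ 2 = ∑ i, x i ^ 2 := Real.sq_sqrt hpos.le
  set B := ∑ i, (s⁻¹ * x i) • A i with hB
  have hscale : ∀ t : ℝ, M + t • B = M + ∑ i, (t * (s⁻¹ * x i)) • A i := fun t => by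
    rw [hB, Finset.smul_sum]
    simp only [smul_smul]
  have hnorm : ∀ t : ℝ, ∑ i, (t * (s⁻¹ * x i)) ^ 2 = t ^ 2 := fun t => by
    simp only [mul_pow, ← Finset.mul_sum, ← hs2]
    field_simp
  have hpsd : ∀ t : ℝ, (M + t • B).PosSemidef ↔ t ^ 2 ≤ 1 := fun t => by
    rw [hscale, H (fun i => t * (s⁻¹ * x i)), hnorm]
  have h1 : (M + B).PosSemidef := by simpa using (hpsd 1).2 (by norm_num)
  have hBh : B.IsHermitian := by
    rw [IsHermitian, conjTranspose_eq_transpose_of_trivial, hB, transpose_sum]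
    simp only [transpose_smul, (hA _).eq]
  have hdet : (M + B).det = 0 := by
    by_contra hd
    obtain ⟨ε, hε, hP⟩ := (h1.posDef_iff_det_ne_zero.2 hd).exists_posSemidef_add_smul hBh
    rw [add_assoc, show B + ε • B = (1 + ε) • B by rw [add_smul, one_smul], hpsd] at hP
    nlinarith
  obtain ⟨u, hu, hMu⟩ := exists_mulVec_eq_zero_iff.2 hdet
  refine ⟨u, hu, ?_⟩
  have h2 : s • M + ∑ i, x i • A i = s • (M + B) := by
    rw [smul_add, hB, Finset.smul_sum]
    simp only [smul_smul, ← mul_assoc, mul_inv_cancel₀ hs0.ne', one_mul]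
  rw [h2, smul_mulVec, hMu, smul_zero]

/-- A linear matrix inequality of size `r` describing the unit ball yields an expression of
`x₁² + ⋯ + xₙ²` as a quotient of two sums of `r` squares of polynomials. -/
theorem exists_sum_sq_of_ball_pencil {n r : ℕ} (hn : 0 < n) {M : Matrix (Fin r) (Fin r) ℝ}
    {A : Fin n → Matrix (Fin r) (Fin r) ℝ} (hM : M.PosDef) (hA : ∀ i, (A i).IsSymm)
    (H : ∀ p : Fin n → ℝ, (M + ∑ i, p i • A i).PosSemidef ↔ ∑ i, p i ^ 2 ≤ 1) :
    ∃ α β : Fin r → MvPolynomial (Fin n) ℝ, β ≠ 0 ∧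
      ∑ i, α i ^ 2 = (∑ i, MvPolynomial.X i ^ 2) * ∑ i, β i ^ 2 := by
  let R := MvPolynomial (Fin n) ℝ
  let N : R := ∑ i, MvPolynomial.X i ^ 2
  let B : Matrix (Fin r) (Fin r) R := ∑ i, (MvPolynomial.X i : R) • (A i).map MvPolynomial.C
  let M' : Matrix (Fin r) (Fin r) R := M.map MvPolynomial.C
  have hBt : Bᵀ = B := by
    simp only [B, transpose_sum, transpose_smul, ← transpose_map, (hA _).eq]
  obtain ⟨S, hS⟩ := hM.posSemidef.exists_eq_transpose_mul_self
  let S' : Matrix (Fin r) (Fin r) R := S.map MvPolynomial.C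
  have hS' : M' = S'ᵀ * S' := by
    simp only [M', S', hS, ← transpose_map]
    exact Matrix.map_mul
  have hMinj : ∀ v : Fin r → R, M' *ᵥ v = 0 → v = 0 := by
    intro v hv
    have hd : M'.det ≠ 0 := by
      have : M'.det = MvPolynomial.C M.det := (RingHom.map_det MvPolynomial.C M).symm
      rw [this, Ne, MvPolynomial.C_eq_zero]
      exact hM.det_pos.ne'
    exact eq_zero_of_mulVec_eq_zero hd hv
  -- This block matrix is √N·M + B acting on a + √N·b, written without adjoining √N. Its determinant
  -- is a polynomial vanishing at every real point.
  have hdet : (fromBlocks B (N • M') M' B).det = 0 := by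
    refine MvPolynomial.funext fun x => ?_
    have hBx : B.map (MvPolynomial.eval x) = ∑ i, x i • A i := by
      ext a b
      simp [B, Matrix.sum_apply]
    have hMx : M'.map (MvPolynomial.eval x) = M := by
      ext a b
      simp [M']
    have hNMx : (N • M').map (MvPolynomial.eval x) = (∑ i, x i ^ 2) • M := by
      ext a b
      simp [M', N]
    rw [RingHom.map_det, map_zero, RingHom.mapMatrix_apply, fromBlocks_map, hBx, hMx, hNMx]
    obtain ⟨u, hu, hMu⟩ := exists_ball_pencil_kernel hn hA H x
    refine exists_mulVec_eq_zero_iff.1 ⟨Sum.elim (√(∑ i, x i ^ 2) • u) u, fun h0 => hu ?_, ?_⟩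
    · ext i
      exact congrFun h0 (Sum.inr i)
    · have hsq : √(∑ i, x i ^ 2) * √(∑ i, x i ^ 2) = ∑ i, x i ^ 2 :=
        Real.mul_self_sqrt (Finset.sum_nonneg fun _ _ => sq_nonneg _)
      rw [fromBlocks_mulVec]
      have h1 : (√(∑ i, x i ^ 2)) • M *ᵥ u + (∑ i, x i • A i) *ᵥ u = 0 := by
        rwa [add_mulVec, smul_mulVec] at hMu
      ext (i | i)
      · have h2 := congrFun h1 i
        simp only [Pi.add_apply, Pi.smul_apply, smul_eq_mul, Pi.zero_apply] at h2
        simp only [Sum.elim_comp_inl, Sum.elim_comp_inr, Sum.elim_inl, mulVec_smul, smul_mulVec,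
          Pi.add_apply, Pi.smul_apply, smul_eq_mul, Pi.zero_apply]
        linear_combination √(∑ i, x i ^ 2) * h2 - (M *ᵥ u) i * hsq
      · simpa [mulVec_smul] using congrFun h1 i
  obtain ⟨w, hw, hw0⟩ := exists_mulVec_eq_zero_iff.2 hdet
  rw [fromBlocks_mulVec] at hw0
  set a : Fin r → R := w ∘ Sum.inl with ha
  set b : Fin r → R := w ∘ Sum.inr with hb
  have e1 : B *ᵥ a + N • M' *ᵥ b = 0 := by
    ext1 i
    simpa [smul_mulVec] using congrFun hw0 (Sum.inl i)
  have e2 : M' *ᵥ a + B *ᵥ b = 0 := by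
    ext1 i
    exact congrFun hw0 (Sum.inr i)
  have hb0 : b ≠ 0 := by
    intro h0
    rw [h0, mulVec_zero, add_zero] at e2
    have ha0 := hMinj a e2
    refine hw (funext ?_)
    rintro (i | i)
    · exact congrFun ha0 i
    · exact congrFun h0 i
  -- Pair the first kernel equation with b and the second with a; the symmetry of B eliminates the
  -- mixed term.
  have hquad : a ⬝ᵥ M' *ᵥ a = N * (b ⬝ᵥ M' *ᵥ b) := by
    have h1 := congrArg (fun v => b ⬝ᵥ v) e1
    have h2 := congrArg (fun v => a ⬝ᵥ v) e2
    simp only [dotProduct_add, dotProduct_smul, smul_eq_mul, dotProduct_zero] at h1 h2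
    have h3 : a ⬝ᵥ B *ᵥ b = b ⬝ᵥ B *ᵥ a := by
      rw [dotProduct_mulVec, ← mulVec_transpose, hBt, dotProduct_comm]
    rw [h3] at h2
    linear_combination h2 - h1
  have hsq : ∀ v : Fin r → R, ∑ i, (S' *ᵥ v) i ^ 2 = v ⬝ᵥ M' *ᵥ v := fun v => by
    rw [hS', ← mulVec_mulVec, dotProduct_mulVec, vecMul_transpose]
    simp only [dotProduct, sq]
  refine ⟨S' *ᵥ a, S' *ᵥ b, fun h0 => hb0 (hMinj b ?_), ?_⟩
  · rw [hS', ← mulVec_mulVec, h0, mulVec_zero]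
  · rw [hsq, hsq, hquad]

end Matrix

/-! ### The unit ball: lower bounds, affine pullback, standard description -/

theorem mem_closedBall_zero_one_iff {n : ℕ} (p : EuclideanSpace ℝ (Fin n)) :
    p ∈ Metric.closedBall (0 : EuclideanSpace ℝ (Fin n)) 1 ↔ ∑ i, p i ^ 2 ≤ 1 := by
  rw [EuclideanSpace.closedBall_zero_eq 1 zero_le_one, one_pow]
  rfl

/-- Lower bounds for the size of a spectrahedral description of the unit ball. -/
theorem pos_and_two_pow_lt_of_mem_descriptionSizes_ball {n r : ℕ} (hn : 0 < n)
    (hr : r ∈ descriptionSizes (Metric.closedBall (0 : EuclideanSpace ℝ (Fin n)) 1)) :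
    0 < r ∧ ∀ k : ℕ, 2 ^ k < n → 2 ^ k < r := by
  obtain ⟨A₀, A, -, hA, hC⟩ := hr
  have H : ∀ p : Fin n → ℝ, (A₀ + ∑ i, p i • A i).PosSemidef ↔ ∑ i, p i ^ 2 ≤ 1 := fun p => by
    have h1 := mem_closedBall_zero_one_iff (WithLp.toLp 2 p)
    rw [hC] at h1
    exact h1
  obtain ⟨M, hM, HM⟩ := Matrix.exists_posDef_of_ball_pencil hA H
  obtain ⟨α, β, hβ, hαβ⟩ := Matrix.exists_sum_sq_of_ball_pencil hn hM hA HM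
  refine ⟨?_, fun k hk => two_pow_lt_of_sum_sq_eq hk hβ hαβ⟩
  obtain ⟨i, -⟩ := Function.ne_iff.1 hβ
  exact i.pos

/-- Pulling back a linear matrix inequality along an affine map. -/
theorem descriptionSizes_subset_of_affine {n : ℕ} {C D : Set (EuclideanSpace ℝ (Fin n))}
    (x₀ : Fin n → ℝ) (T : Matrix (Fin n) (Fin n) ℝ)
    (hD : ∀ p : EuclideanSpace ℝ (Fin n), p ∈ D ↔ WithLp.toLp 2 (x₀ + T.mulVec p) ∈ C) :
    descriptionSizes C ⊆ descriptionSizes D := by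
  rintro r ⟨A₀, A, h₀, hA, hC⟩
  refine ⟨A₀ + ∑ i, x₀ i • A i, fun j => ∑ i, T i j • A i, ?_, fun j => ?_, ?_⟩
  · simp only [Matrix.IsSymm, Matrix.transpose_add, Matrix.transpose_sum, Matrix.transpose_smul,
      h₀.eq, (hA _).eq]
  · simp only [Matrix.IsSymm, Matrix.transpose_sum, Matrix.transpose_smul, (hA _).eq]
  · ext p
    rw [hD, hC]
    have : ∑ j, p j • ∑ i, T i j • A i = ∑ i, (T.mulVec p) i • A i := by
      simp only [Finset.smul_sum, smul_smul, Matrix.mulVec, dotProduct, Finset.sum_smul]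
      rw [Finset.sum_comm]
      simp only [mul_comm]
    simp only [lmiSet, Set.mem_ofPred_eq, this, Pi.add_apply, add_smul, Finset.sum_add_distrib,
      add_assoc]

open Matrix in
theorem standardBallCoeff_zero (m : ℕ) :
    standardBallCoeff (m + 1) 0 = diagonal (Fin.cons 1 fun _ => -1) := by
  ext i j
  refine Fin.cases ?_ (fun i => ?_) i <;> refine Fin.cases ?_ (fun j => ?_) j <;>
    simp [standardBallCoeff, diagonal_apply]

open Matrix in
theorem standardBallCoeff_succ (m : ℕ) (l : Fin m) :
    standardBallCoeff (m + 1) l.succ = single 0 l.succ 1 + single l.succ 0 1 := by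
  ext i j
  refine Fin.cases ?_ (fun i => ?_) i <;> refine Fin.cases ?_ (fun j => ?_) j <;>
    simp [standardBallCoeff, single_apply, eq_comm]

theorem standardBallCoeff_isSymm (n : ℕ) (l : Fin n) : (standardBallCoeff n l).IsSymm := by
  cases n with
  | zero => exact l.elim0
  | succ m =>
    refine Fin.cases ?_ (fun l => ?_) l
    · rw [standardBallCoeff_zero]
      exact Matrix.isSymm_diagonal _
    · rw [standardBallCoeff_succ, Matrix.IsSymm, Matrix.transpose_add, Matrix.transpose_single,
        Matrix.transpose_single]
      exact add_comm _ _

open Matrix in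
theorem standardBall_quadraticForm (m : ℕ) (p v : Fin (m + 1) → ℝ) :
    v ⬝ᵥ (1 + ∑ l, p l • standardBallCoeff (m + 1) l) *ᵥ v =
      (1 + p 0) * v 0 ^ 2 + 2 * v 0 * ∑ l : Fin m, p l.succ * v l.succ +
        (1 - p 0) * ∑ l : Fin m, v l.succ ^ 2 := by
  have h0 : v ⬝ᵥ standardBallCoeff (m + 1) 0 *ᵥ v = v 0 ^ 2 - ∑ l : Fin m, v l.succ ^ 2 := by
    rw [standardBallCoeff_zero]
    simp only [dotProduct, mulVec_diagonal, Fin.sum_univ_succ, Fin.cons_zero, Fin.cons_succ]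
    rw [sub_eq_add_neg, ← Finset.sum_neg_distrib]
    congr 1
    · ring
    · exact Finset.sum_congr rfl fun i _ => by ring
  have hs : ∀ l : Fin m, v ⬝ᵥ standardBallCoeff (m + 1) l.succ *ᵥ v = 2 * v 0 * v l.succ := by
    intro l
    rw [standardBallCoeff_succ, add_mulVec, dotProduct_add, single_mulVec, single_mulVec]
    simp [dotProduct, Function.update_apply]
    ring
  rw [add_mulVec, one_mulVec, dotProduct_add, sum_mulVec, dotProduct_sum]
  simp only [smul_mulVec, dotProduct_smul, Fin.sum_univ_succ, h0, hs, smul_eq_mul]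
  have h1 : v ⬝ᵥ v = v 0 ^ 2 + ∑ l : Fin m, v l.succ ^ 2 := by
    simp only [dotProduct, Fin.sum_univ_succ, sq]
  have h2 : ∑ l : Fin m, p l.succ * (2 * v 0 * v l.succ) =
      2 * v 0 * ∑ l : Fin m, p l.succ * v l.succ := by
    rw [Finset.mul_sum]
    exact Finset.sum_congr rfl fun i _ => by ring
  rw [h1, h2]
  ring

theorem isSpectrahedralDescription_standardBall {n : ℕ} (hn : 2 ≤ n) :
    IsSpectrahedralDescription (Metric.closedBall (0 : EuclideanSpace ℝ (Fin n)) 1)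
      1 (standardBallCoeff n) := by
  obtain ⟨m, rfl⟩ := Nat.exists_eq_add_of_le' (show 1 ≤ n by omega)
  refine ⟨Matrix.isSymm_one, standardBallCoeff_isSymm _, ?_⟩
  ext p
  rw [mem_closedBall_zero_one_iff, Fin.sum_univ_succ]
  set s := ∑ l : Fin m, p l.succ ^ 2 with hs
  have hs0 : 0 ≤ s := Finset.sum_nonneg fun _ _ => sq_nonneg _
  constructor
  · intro hp
    refine Matrix.PosSemidef.of_dotProduct_mulVec_nonneg ?_ fun v => ?_
    · rw [Matrix.IsHermitian, Matrix.conjTranspose_eq_transpose_of_trivial, Matrix.transpose_add,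
        Matrix.transpose_sum]
      simp only [Matrix.transpose_smul, (standardBallCoeff_isSymm _ _).eq, Matrix.transpose_one]
    · rw [star_trivial, standardBall_quadraticForm m p v]
      set V := ∑ l : Fin m, v l.succ ^ 2 with hV
      set c := ∑ l : Fin m, p l.succ * v l.succ with hc
      have hV0 : 0 ≤ V := Finset.sum_nonneg fun _ _ => sq_nonneg _
      have hcs : c ^ 2 ≤ s * V := Finset.sum_mul_sq_le_sq_mul_sq _ _ _
      obtain ⟨h1, h2⟩ := abs_le.1 ((sq_le_one_iff_abs_le_one (p 0)).1 (by linarith))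
      -- Cauchy–Schwarz with s ≤ 1 - p₀² gives the discriminant bound for the form as a quadratic in
      -- v₀.
      have hcab : c ^ 2 ≤ (1 + p 0) * ((1 - p 0) * V) := by nlinarith
      have hb : 0 ≤ (1 - p 0) * V := mul_nonneg (by linarith) hV0
      rcases (show 0 ≤ 1 + p 0 by linarith).eq_or_lt with ha | ha
      · rw [← ha, zero_mul] at hcab
        have hc0 : c = 0 := by nlinarith
        rw [← ha, hc0]
        linarith
      · refine nonneg_of_mul_nonneg_right ?_ ha
        nlinarith [sq_nonneg ((1 + p 0) * v 0 + c)]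
  · intro hp
    have hq : ∀ v : Fin (m + 1) → ℝ, 0 ≤ (1 + p 0) * v 0 ^ 2 +
        2 * v 0 * ∑ l : Fin m, p l.succ * v l.succ + (1 - p 0) * ∑ l : Fin m, v l.succ ^ 2 :=
      fun v => by
        rw [← standardBall_quadraticForm m p v]
        simpa using Matrix.PosSemidef.dotProduct_mulVec_nonneg hp v
    -- The test vector needs a second coordinate, which is where n ≥ 2 enters; for n = 1 the
    -- inequality describes a half-line.
    have h1 : 0 ≤ 1 - p 0 := by
      simpa [Pi.single_apply] using hq (Fin.cons 0 (Pi.single ⟨0, by omega⟩ 1))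
    have h2 : ∀ t : ℝ, 0 ≤ (1 + p 0) * t ^ 2 + 2 * t * s + (1 - p 0) * s := fun t => by
      simpa [← sq] using hq (Fin.cons t fun l => p l.succ)
    rcases h1.eq_or_lt with h | h
    -- At p₀ = 1 this value of t gives -s²/2 ≥ 0, hence s = 0.
    · have h3 := h2 (-s / 2)
      have h4 : p 0 = 1 := by linarith
      rw [h4] at h3 ⊢
      nlinarith
    -- For this t the form factors as (1 - p₀)(1 - p₀² - s).
    · have h3 := h2 (-(1 - p 0))
      have h4 : 0 ≤ (1 - p 0) * (1 - p 0 ^ 2 - s) := by linarith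
      have h5 := nonneg_of_mul_nonneg_right h4 h
      linarith

/-! ### Compact quadratic superlevel sets are ellipsoids -/

open Matrix in
/-- A real polynomial of degree at most two is a quadratic function. -/
theorem MvPolynomial.exists_quadratic_of_totalDegree_le_two {n : ℕ} {f : MvPolynomial (Fin n) ℝ}
    (hf : f.totalDegree ≤ 2) : ∃ (P : Matrix (Fin n) (Fin n) ℝ) (b : Fin n → ℝ) (c : ℝ),
      P.IsSymm ∧ ∀ x, MvPolynomial.eval x f = c + b ⬝ᵥ x - x ⬝ᵥ P *ᵥ x := by
  suffices h : ∃ (M : Matrix (Fin n) (Fin n) ℝ) (b : Fin n → ℝ) (c : ℝ),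
      ∀ x, MvPolynomial.eval x f = c + b ⬝ᵥ x + x ⬝ᵥ M *ᵥ x by
    obtain ⟨M, b, c, h⟩ := h
    refine ⟨-(1 / 2 : ℝ) • (M + Mᵀ), b, c, ?_, fun x => ?_⟩
    · rw [IsSymm, transpose_smul, transpose_add, transpose_transpose, add_comm]
    · have h1 : x ⬝ᵥ Mᵀ *ᵥ x = x ⬝ᵥ M *ᵥ x := by
        rw [mulVec_transpose, dotProduct_comm, dotProduct_mulVec]
      rw [h, smul_mulVec, dotProduct_smul, add_mulVec, dotProduct_add, h1, smul_eq_mul]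
      ring
  rw [← MvPolynomial.support_sum_monomial_coeff f]
  refine Finset.sum_induction _ (fun g => ∃ (M : Matrix (Fin n) (Fin n) ℝ) (b : Fin n → ℝ) (c : ℝ),
      ∀ x, MvPolynomial.eval x g = c + b ⬝ᵥ x + x ⬝ᵥ M *ᵥ x) ?_ ?_ ?_
  · rintro g g' ⟨M, b, c, h⟩ ⟨M', b', c', h'⟩
    refine ⟨M + M', b + b', c + c', fun x => ?_⟩
    rw [map_add, h, h', add_mulVec, dotProduct_add, add_dotProduct]
    ring
  · exact ⟨0, 0, 0, fun x => by simp⟩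
  · intro s hs
    have hcard : Multiset.card (Finsupp.toMultiset s) ≤ 2 := by
      rw [Finsupp.card_toMultiset]
      exact (MvPolynomial.le_totalDegree hs).trans hf
    generalize MvPolynomial.coeff s f = a
    have hs' : s = Multiset.toFinsupp (Finsupp.toMultiset s) := by simp
    rw [hs']
    generalize Finsupp.toMultiset s = t at hcard
    interval_cases ht : Multiset.card t
    · rw [Multiset.card_eq_zero] at ht
      exact ⟨0, 0, a, fun x => by simp [ht]⟩
    · obtain ⟨i, rfl⟩ := Multiset.card_eq_one.1 ht
      refine ⟨0, Pi.single i a, 0, fun x => ?_⟩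
      simp [MvPolynomial.eval_monomial]
    · obtain ⟨i, j, rfl⟩ := Multiset.card_eq_two.1 ht
      refine ⟨single i j a, 0, 0, fun x => ?_⟩
      have h1 : x ⬝ᵥ single i j a *ᵥ x = a * (x i * x j) := by
        rw [single_mulVec]
        simp [dotProduct, Function.update_apply]
        ring
      have h2 : Multiset.toFinsupp {i, j} = Finsupp.single i 1 + Finsupp.single j 1 := by
        rw [Multiset.insert_eq_cons, ← Multiset.singleton_add, map_add,
          Multiset.toFinsupp_singleton, Multiset.toFinsupp_singleton]
      rw [h1, h2, MvPolynomial.eval_monomial, Finsupp.prod_add_index' (by simp)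
        (fun _ _ _ => pow_add _ _ _)]
      simp

open Matrix in
/-- A quadratic function whose superlevel set is bounded and nonempty has a negative definite
leading form. -/
theorem Matrix.posDef_of_isBounded_superlevel {n : ℕ} {P : Matrix (Fin n) (Fin n) ℝ}
    (hP : P.IsSymm) {b : Fin n → ℝ} {c : ℝ}
    (hb : Bornology.IsBounded {p : EuclideanSpace ℝ (Fin n) | 0 ≤ c + b ⬝ᵥ p - p ⬝ᵥ P *ᵥ p})
    (hne : {p : EuclideanSpace ℝ (Fin n) | 0 ≤ c + b ⬝ᵥ p - p ⬝ᵥ P *ᵥ p}.Nonempty) :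
    P.PosDef := by
  refine .of_dotProduct_mulVec_pos
    (by rw [IsHermitian, conjTranspose_eq_transpose_of_trivial, hP.eq]) fun v hv => ?_
  by_contra! hneg
  rw [star_trivial] at hneg
  obtain ⟨p, hp⟩ := hne
  rw [Set.mem_ofPred_eq] at hp
  obtain ⟨R, hR⟩ := hb.exists_norm_le
  -- β is the derivative of the function at p along v. If vᵀPv ≤ 0, moving from p in a direction
  -- where tβ ≥ 0 never leaves the set, contradicting boundedness.
  set β := b ⬝ᵥ v - 2 * (v ⬝ᵥ P *ᵥ p) with hβ
  have hmem : ∀ t : ℝ, 0 ≤ t * β → ‖p + t • WithLp.toLp 2 v‖ ≤ R := by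
    intro t ht
    refine hR _ ?_
    rw [Set.mem_ofPred_eq]
    have h1 : (p + t • WithLp.toLp 2 v : EuclideanSpace ℝ (Fin n)).ofLp = p.ofLp + t • v := rfl
    have h2 : p.ofLp ⬝ᵥ P *ᵥ v = v ⬝ᵥ P *ᵥ p.ofLp := by
      rw [dotProduct_mulVec, ← mulVec_transpose, hP.eq, dotProduct_comm]
    rw [h1]
    simp only [mulVec_add, mulVec_smul, dotProduct_add, dotProduct_smul, add_dotProduct,
      smul_dotProduct, smul_eq_mul, h2]
    have h3 : 0 ≤ t * t * -(v ⬝ᵥ P *ᵥ v) := mul_nonneg (mul_self_nonneg t) (by linarith)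
    rw [hβ] at ht
    linarith
  have hv' : 0 < ‖WithLp.toLp 2 v‖ := norm_pos_iff.2 (by simpa using hv)
  have hlt : ∀ t : ℝ, 0 ≤ t * β → |t| * ‖WithLp.toLp 2 v‖ ≤ R + ‖p‖ := by
    intro t ht
    have h1 := norm_sub_le (p + t • WithLp.toLp 2 v) p
    rw [add_sub_cancel_left, norm_smul, Real.norm_eq_abs] at h1
    linarith [hmem t ht]
  have key : ∀ t : ℝ, |t| * ‖WithLp.toLp 2 v‖ ≤ R + ‖p‖ := fun t => by
    rcases le_total 0 (t * β) with h | h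
    · exact hlt t h
    · simpa using hlt (-t) (by linarith)
  have h1 := key ((R + ‖p‖ + 1) / ‖WithLp.toLp 2 v‖)
  have h2 := le_abs_self ((R + ‖p‖ + 1) / ‖WithLp.toLp 2 v‖)
  have h3 : (R + ‖p‖ + 1) / ‖WithLp.toLp 2 v‖ * ‖WithLp.toLp 2 v‖ = R + ‖p‖ + 1 :=
    div_mul_cancel₀ _ hv'.ne'
  nlinarith

open Matrix in
/-- A compact set with nonempty interior that is defined by one quadratic inequality is an
ellipsoid. -/
theorem exists_ellipsoid_of_quadratic {n : ℕ} (hn : 0 < n) {f : MvPolynomial (Fin n) ℝ}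
    (hf : f.totalDegree ≤ 2) (hcomp : IsCompact (nonnegSet f))
    (hint : (interior (nonnegSet f)).Nonempty) :
    ∃ (x₀ : Fin n → ℝ) (T : Matrix (Fin n) (Fin n) ℝ), IsUnit T.det ∧
      ∀ p : EuclideanSpace ℝ (Fin n),
        p ∈ nonnegSet f ↔ ∑ i, (T *ᵥ (p.ofLp - x₀)) i ^ 2 ≤ 1 := by
  obtain ⟨P, b, c, hP, h⟩ := MvPolynomial.exists_quadratic_of_totalDegree_le_two hf
  have hset : nonnegSet f =
      {p : EuclideanSpace ℝ (Fin n) | 0 ≤ c + b ⬝ᵥ p - p ⬝ᵥ P *ᵥ p} := by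
    ext p
    rw [nonnegSet, Set.mem_ofPred_eq, Set.mem_ofPred_eq, ← h p]
  have hpos : P.PosDef := posDef_of_isBounded_superlevel hP (hset ▸ hcomp.isBounded)
    (hset ▸ hint.mono interior_subset)
  have hdet : IsUnit P.det := (isUnit_iff_isUnit_det P).1 hpos.isUnit
  -- Completing the square gives f(p) = d - (p - x₀)ᵀP(p - x₀).
  set x₀ : Fin n → ℝ := (1 / 2 : ℝ) • P⁻¹ *ᵥ b with hx₀
  have hPx : P *ᵥ x₀ = (1 / 2 : ℝ) • b := by
    rw [hx₀, mulVec_smul, mulVec_mulVec, mul_nonsing_inv P hdet, one_mulVec]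
  set d := c + x₀ ⬝ᵥ P *ᵥ x₀ with hd
  have hmem : ∀ p : EuclideanSpace ℝ (Fin n), p ∈ nonnegSet f ↔
      (p.ofLp - x₀) ⬝ᵥ P *ᵥ (p.ofLp - x₀) ≤ d := by
    intro p
    have h2 : x₀ ⬝ᵥ P *ᵥ p.ofLp = p.ofLp ⬝ᵥ P *ᵥ x₀ := by
      rw [dotProduct_mulVec, ← mulVec_transpose, hP.eq, dotProduct_comm]
    have h3 : b ⬝ᵥ p.ofLp = p.ofLp ⬝ᵥ b := dotProduct_comm _ _
    rw [hset, Set.mem_ofPred_eq, mulVec_sub, sub_dotProduct, dotProduct_sub, dotProduct_sub, h2, hd,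
      hPx, h3]
    simp only [dotProduct_smul, smul_eq_mul]
    constructor <;> intro h <;> linarith
  -- For d ≤ 0 the set has at most one point, hence empty interior as n > 0.
  have hd0 : 0 < d := by
    by_contra! hd0
    have hsub : nonnegSet f ⊆ {WithLp.toLp 2 x₀} := by
      intro p hp
      rw [hmem] at hp
      have h0 : p.ofLp - x₀ = 0 := by
        by_contra hne
        have := hpos.dotProduct_mulVec_pos hne
        rw [star_trivial] at this
        linarith
      rw [Set.mem_singleton_iff, ← sub_eq_zero.1 h0]
    have : Nonempty (Fin n) := ⟨⟨0, hn⟩⟩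
    have h1 := hint.mono (interior_mono hsub)
    rw [interior_singleton] at h1
    exact Set.not_nonempty_empty h1
  obtain ⟨S, hS⟩ := hpos.posSemidef.exists_eq_transpose_mul_self
  have hsq : ∀ v : Fin n → ℝ, ∑ i, (S *ᵥ v) i ^ 2 = v ⬝ᵥ P *ᵥ v := fun v => by
    rw [hS, ← mulVec_mulVec, dotProduct_mulVec, vecMul_transpose]
    simp only [dotProduct, sq]
  refine ⟨x₀, (√d)⁻¹ • S, ?_, fun p => ?_⟩
  · have hSdet : S.det ≠ 0 := by
      intro h0
      rw [hS, det_mul, h0, mul_zero] at hdet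
      exact not_isUnit_zero hdet
    rw [det_smul, isUnit_iff_ne_zero]
    exact mul_ne_zero (pow_ne_zero _ (inv_ne_zero (Real.sqrt_pos.2 hd0).ne')) hSdet
  · rw [hmem, ← hsq]
    simp only [smul_mulVec, Pi.smul_apply, smul_eq_mul, mul_pow, ← Finset.mul_sum, inv_pow,
      Real.sq_sqrt hd0.le]
    rw [inv_mul_le_iff₀ hd0, mul_one]

/-- A compact set with nonempty interior that is defined by one quadratic inequality has the same
description sizes as the unit ball. -/
theorem descriptionSizes_nonnegSet_eq_ball {n : ℕ} (hn : 0 < n) {f : MvPolynomial (Fin n) ℝ}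
    (hf : f.totalDegree ≤ 2) (hcomp : IsCompact (nonnegSet f))
    (hint : (interior (nonnegSet f)).Nonempty) :
    descriptionSizes (nonnegSet f) =
      descriptionSizes (Metric.closedBall (0 : EuclideanSpace ℝ (Fin n)) 1) := by
  obtain ⟨x₀, T, hT, h⟩ := exists_ellipsoid_of_quadratic hn hf hcomp hint
  apply Set.Subset.antisymm
  · refine descriptionSizes_subset_of_affine x₀ T⁻¹ fun p => ?_
    rw [h, mem_closedBall_zero_one_iff]
    simp [Matrix.mulVec_mulVec, Matrix.mul_nonsing_inv T hT]
  · refine descriptionSizes_subset_of_affine (-T.mulVec x₀) T fun p => ?_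
    rw [h, mem_closedBall_zero_one_iff, Matrix.mulVec_sub, sub_eq_neg_add]

/-! ### The main theorem -/

theorem theorem2p1 (n : ℕ) :
    (∀ f : MvPolynomial (Fin n) ℝ, f.totalDegree = 2 →
      IsCompact (nonnegSet f) → Convex ℝ (nonnegSet f) → (interior (nonnegSet f)).Nonempty →
      (∀ (r : ℕ) (A₀ : Matrix (Fin r) (Fin r) ℝ) (A : Fin n → Matrix (Fin r) (Fin r) ℝ),
        IsSpectrahedralDescription (nonnegSet f) A₀ A →
          (∀ k : ℕ, 2 ^ k < n → 2 ^ k < r) ∧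
          (n : ℝ) / 2 ≤ (r : ℝ) ∧
          (∀ k : ℕ, n = 2 ^ k + 1 → n ≤ r)) ∧
      (∀ k : ℕ, n = 2 ^ k + 1 → IsLeast (descriptionSizes (nonnegSet f)) n)) ∧
    (2 ≤ n →
      IsSpectrahedralDescription (Metric.closedBall (0 : EuclideanSpace ℝ (Fin n)) 1)
        1 (standardBallCoeff n)) := by
  refine ⟨fun f hf hcomp _ hint => ?_, isSpectrahedralDescription_standardBall⟩
  have hn : 0 < n := by
    rcases Nat.eq_zero_or_pos n with rfl | hn
    · rw [MvPolynomial.eq_C_of_isEmpty f, MvPolynomial.totalDegree_C] at hf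
      omega
    · exact hn
  have hsizes := descriptionSizes_nonnegSet_eq_ball hn hf.le hcomp hint
  have hlow : ∀ r ∈ descriptionSizes (nonnegSet f), 0 < r ∧ ∀ k : ℕ, 2 ^ k < n → 2 ^ k < r :=
    fun r hr => pos_and_two_pow_lt_of_mem_descriptionSizes_ball hn (hsizes ▸ hr)
  refine ⟨fun r A₀ A hA => ?_, fun k hk => ⟨?_, fun r hr => ?_⟩⟩
  · obtain ⟨hr, hpow⟩ := hlow r ⟨A₀, A, hA⟩
    refine ⟨hpow, ?_, fun k hk => ?_⟩
    · have h2 : n ≤ 2 * r := by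
        rcases Nat.lt_or_ge n 2 with h | h
        · omega
        -- With 2^k the largest power of 2 below n, n ≤ 2^(k+1) < 2r.
        · have h1 := Nat.pow_log_le_self 2 (show n - 1 ≠ 0 by omega)
          have h2 := Nat.lt_pow_succ_log_self one_lt_two (n - 1)
          have h3 := hpow (Nat.log 2 (n - 1)) (by omega)
          rw [pow_succ] at h2
          omega
      have h3 : (n : ℝ) ≤ 2 * r := by exact_mod_cast h2
      linarith
    · have := hpow k (by omega)
      omega
  · rw [hsizes]
    have := Nat.one_le_two_pow (n := k)
    exact ⟨1, standardBallCoeff n, isSpectrahedralDescription_standardBall (by omega)⟩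
  · have := (hlow r hr).2 k (by omega)
    omega
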